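/- A quandle is a set $X$ with a binary operation $\lhd$ such that $a\lhd a=a$, the map $\bullet\lhd a: X\to X$ is bijective, and $(a\lhd b)\lhd c=(a\lhd c)\lhd(b\lhd c)$ for all $a,b,c\in X$. Its adjoint group is $\mathrm{As}(X)=\langle e_x\ (x\in X)\mid e_{x\lhd y}=e_y^{-1}e_xe_y\ (x,y\in X)\rangle$, which acts on $X$ from the right by $x\cdot e_y=x\lhd y$; $X$ is connected if this action has exactly one orbit. $X$ is of type $t_X$ if $t_X$ is the smallest positive integer $N$ such that, for all $x,y\in X$, applying $\bullet\lhd y$ to $x$ exactly $N$ times gives $x$. A quandle covering is a surjective map $p:Y\to Z$ between quandles such that $p(a\lhd b)=p(a)\lhd p(b)$ for all $a,b\in Y$, and such that $p(x)=p(y)$ implies $a\lhd x=a\lhd y$ for all $a,x,y\in Y$. **Proposition.** Let $p:Y\to Z$ be a quandle covering. Then the induced homomorphism $p_*:\mathrm{As}(Y)\to\mathrm{As}(Z)$, $e_y\mapsto e_{p(y)}$, is a central extension, i.e. it is surjective and its kernel is contained in the center of $\mathrm{As}(Y)$. Furthermore, if $Y$ and $Z$ are connected and $Z$ is of (finite)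 type $t_Z$, then the abelian group $\mathrm{Ker}(p_*)$ is annihilated by $t_Z$, i.e. $k^{t_Z}=1$ for every $k\in\mathrm{Ker}(p_*)$. -/

import Mathlib

open scoped Quandles

universe u v

/-!
Quandles are Mathlib's `Quandle`. Mathlib writes `y ◃ x` for the operation of `y` on `x`; in the
right-handed convention `x ⊲ y` for this element, Mathlib's axioms read `x ⊲ x = x`,
`(• ⊲ y)` is bijective, and `(a ⊲ b) ⊲ c = (a ⊲ c) ⊲ (b ⊲ c)`.
-/

namespace QuandleCov

/-- The relators `e_{x ⊲ y}⁻¹ e_y⁻¹ e_x e_y` of the adjoint group, where `x ⊲ y` is `y ◃ x`. -/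
def adjRels (X : Type u) [Quandle X] : Set (FreeGroup X) :=
  {r | ∃ x y : X,
    r = (FreeGroup.of (y ◃ x))⁻¹ * ((FreeGroup.of y)⁻¹ * FreeGroup.of x * FreeGroup.of y)}

/-- The adjoint (associated) group `As(X) = ⟨e_x (x ∈ X) | e_{x ⊲ y} = e_y⁻¹ e_x e_y⟩`. -/
abbrev As (X : Type u) [Quandle X] : Type u := PresentedGroup (adjRels X)

namespace As

variable {X : Type u} [Quandle X]

/-- The generator `e_x` of `As(X)`. -/
def e (x : X) : As X := PresentedGroup.of x

theorem e_act (x y : X) : e (y ◃ x) = (e y)⁻¹ * e x * e y := by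
  have h := PresentedGroup.one_of_mem (rels := adjRels X) ⟨x, y, rfl⟩
  simp only [map_mul, map_inv] at h
  exact inv_mul_eq_one.mp h

/-- The group homomorphism `As(X) → G` that sends `e_x` to `f x`. -/
def lift {G : Type v} [Group G] (f : X → G)
    (hf : ∀ x y : X, f (y ◃ x) = (f y)⁻¹ * f x * f y) : As X →* G :=
  PresentedGroup.toGroup (f := f) (by
    rintro r ⟨x, y, rfl⟩
    simp only [map_mul, map_inv, FreeGroup.lift_apply_of, hf]
    group)

theorem lift_e {G : Type v} [Group G] (f : X → G)
    (hf : ∀ x y : X, f (y ◃ x) = (f y)⁻¹ * f x * f y) (x : X) : lift f hf (e x) = f x :=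
  PresentedGroup.toGroup.of _

/-- The homomorphism `p_* : As(Y) → As(Z)`, `e_y ↦ e_{p y}`, induced by a quandle
homomorphism `p : Y → Z`. -/
def map {Y : Type u} {Z : Type v} [Quandle Y] [Quandle Z] (p : Y →◃ Z) : As Y →* As Z :=
  lift (fun y => e (p y)) (fun x y => by
    rw [ShelfHom.map_act, e_act])

theorem map_e {Y : Type u} {Z : Type v} [Quandle Y] [Quandle Z] (p : Y →◃ Z) (y : Y) :
    map p (e y) = e (p y) :=
  lift_e _ _ y

/-- The right action of `As(X)` on `X` determined by `x · e_y = x ⊲ y`, as a homomorphism to the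
opposite of the group of permutations of `X`. -/
def rightAction (X : Type u) [Quandle X] : As X →* (Equiv.Perm X)ᵐᵒᵖ :=
  lift (fun y => MulOpposite.op (Rack.act' y)) (fun x y => by
    apply MulOpposite.unop_injective
    simp [Rack.ad_conj, mul_assoc])

/-- `x · g` for the right action of `As(X)` on `X`. -/
def smulRight (x : X) (g : As X) : X := (rightAction X g).unop x

theorem smulRight_e (x y : X) : smulRight x (e y) = y ◃ x := by
  simp [smulRight, rightAction, lift_e]

theorem smulRight_one (x : X) : smulRight x (1 : As X) = x := by
  simp [smulRight]

theorem smulRight_mul (x : X) (g h : As X) :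
    smulRight x (g * h) = smulRight (smulRight x g) h := by
  simp [smulRight]

end As

/-- A quandle is connected if the right action of its adjoint group on it has exactly one
orbit. -/
def IsConnected (X : Type u) [Quandle X] : Prop :=
  Nonempty X ∧ ∀ x y : X, ∃ g : As X, As.smulRight x g = y

/-- `X` is of type `t`: `t` is the least `N > 0` such that applying `• ⊲ y` to `x` `N` times
gives back `x`, for all `x, y ∈ X`. In particular `t` is finite. -/
def IsOfType (X : Type u) [Quandle X] (t : ℕ) : Prop :=
  IsLeast {N : ℕ | 0 < N ∧ ∀ x y : X, (fun a : X => y ◃ a)^[N] x = x} t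

/-- A quandle covering: a surjective quandle homomorphism `p : Y → Z` such that `p x = p y`
implies `a ⊲ x = a ⊲ y` for all `a`. -/
structure IsCovering {Y : Type u} {Z : Type v} [Quandle Y] [Quandle Z] (p : Y →◃ Z) : Prop where
  surjective : Function.Surjective p
  act_eq : ∀ a x y : Y, p x = p y → x ◃ a = y ◃ a

/-- A group homomorphism `f : G → H` is a central extension (of `H`) if it is surjective and its
kernel lies in the center of `G`. -/
def IsCentralExtension {G : Type u} {H : Type v} [Group G] [Group H] (f : G →* H) : Prop :=
  Function.Surjective f ∧ f.ker ≤ Subgroup.center G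

end QuandleCov

namespace QuandleCov

namespace As

section

variable {X : Type u} [Quandle X]

/-! Elements of `As X` acting trivially on `X` are central, since `g⁻¹ e_x g = e_{x·g}`. For a
covering, the action of `e_y` depends only on `p y`, so the kernel acts trivially on `Y`. For
torsion, `ker_map_le_ker` reduces the claim to the elements `e_x⁻¹ e_y` with `p x = p y`; these are
central, and `e_x ^ t = e_y ^ t` by connectedness of `Y`. -/

theorem closure_range_e : Subgroup.closure (Set.range (e : X → As X)) = ⊤ :=
  PresentedGroup.closure_range_of _

theorem hom_ext {G : Type v} [Group G] {f g : As X →* G} (h : ∀ x, f (e x) = g (e x)) : f = g :=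
  PresentedGroup.ext h

theorem conj_e (x : X) (g : As X) : g⁻¹ * e x * g = e (smulRight x g) := by
  have hg : g ∈ Subgroup.closure (Set.range (e : X → As X)) := by
    rw [closure_range_e]; exact Subgroup.mem_top g
  induction hg using Subgroup.closure_induction generalizing x with
  | mem _ h =>
    obtain ⟨y, rfl⟩ := h
    rw [smulRight_e, e_act]
  | one => simp [smulRight_one]
  | mul a b _ _ iha ihb =>
    rw [smulRight_mul, ← ihb, ← iha]
    group
  | inv a _ ih =>
    have h := ih (smulRight x a⁻¹)
    rw [← smulRight_mul, inv_mul_cancel, smulRight_one] at h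
    rw [← h]
    group

theorem mem_center_of_commute_e {g : As X} (h : ∀ x, g * e x * g⁻¹ = e x) :
    g ∈ Subgroup.center (As X) := by
  have hconj : (MulAut.conj g).toMonoidHom = MonoidHom.id (As X) := hom_ext fun x => h x
  refine Subgroup.mem_center_iff.mpr fun a => ?_
  have ha : g * a * g⁻¹ = a := DFunLike.congr_fun hconj a
  exact (mul_inv_eq_iff_eq_mul.mp ha).symm

theorem mem_center_of_smulRight_eq {g : As X} (h : ∀ x, smulRight x g = x) :
    g ∈ Subgroup.center (As X) := by
  refine mem_center_of_commute_e fun x => ?_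
  have hx := conj_e x g
  rw [h] at hx
  nth_rewrite 1 [← hx]
  group

theorem smulRight_e_pow (x y : X) (n : ℕ) :
    smulRight x (e y ^ n) = (fun a : X => y ◃ a)^[n] x := by
  induction n with
  | zero => simp [smulRight_one]
  | succ n ih => rw [pow_succ, smulRight_mul, ih, smulRight_e, Function.iterate_succ_apply']

theorem e_pow_mem_center {t : ℕ} (ht : IsOfType X t) (x : X) :
    e x ^ t ∈ Subgroup.center (As X) :=
  mem_center_of_smulRight_eq fun y => by rw [smulRight_e_pow, ht.1.2]

end

variable {Y : Type u} {Z : Type v} [Quandle Y] [Quandle Z] {p : Y →◃ Z}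

theorem map_surjective (hp : Function.Surjective p) : Function.Surjective (map p) := by
  rw [← MonoidHom.range_eq_top, eq_top_iff, ← closure_range_e, Subgroup.closure_le]
  rintro _ ⟨z, rfl⟩
  obtain ⟨y, rfl⟩ := hp z
  exact ⟨e y, map_e p y⟩

/-- If a homomorphism on `As(Y)` takes equal values at `e_x`, `e_y` whenever `p x = p y`, then it
kills the kernel of `p_*`. -/
theorem ker_map_le_ker (hp : Function.Surjective p) {G : Type*} [Group G] (f : As Y →* G)
    (hf : ∀ x y, p x = p y → f (e x) = f (e y)) : (map p).ker ≤ f.ker := by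
  have hs := Function.surjInv_eq hp
  -- `f` factors through `p_*` via a set-theoretic section of `p`; `hf` makes the choice of section
  -- harmless.
  have hcomp : (lift (fun z => f (e (Function.surjInv hp z))) (fun x y => by
      rw [← map_inv, ← map_mul, ← map_mul, ← e_act]
      exact hf _ _ (by rw [ShelfHom.map_act, hs, hs, hs]))).comp (map p) = f :=
    hom_ext fun y => by
      rw [MonoidHom.comp_apply, map_e, lift_e]
      exact hf _ _ (hs _)
  intro k hk
  rw [MonoidHom.mem_ker] at hk ⊢
  rw [← hcomp, MonoidHom.comp_apply, hk, map_one]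

end As

namespace IsCovering

open As

variable {Y : Type u} {Z : Type v} [Quandle Y] [Quandle Z] {p : Y →◃ Z}

theorem ker_map_le_center (hp : IsCovering p) : (map p).ker ≤ Subgroup.center (As Y) := by
  intro k hk
  have h : k ∈ (rightAction Y).ker := ker_map_le_ker hp.surjective _ (fun x y hxy => by
    apply MulOpposite.unop_injective
    ext a
    exact (smulRight_e a x).trans ((hp.act_eq a x y hxy).trans (smulRight_e a y).symm)) hk
  rw [MonoidHom.mem_ker] at h
  exact mem_center_of_smulRight_eq fun y => by simp [smulRight, h]

/-- The type of `Z` only makes the image of `e_y ^ t` central in `As Z`. Hence its commutator `z`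
with any `g` lies in the kernel and is central; conjugating `g⁻¹ e_y g` by `e_y ^ t` turns `g` into
`z g`, and `z` cancels. -/
theorem e_pow_mem_center (hp : IsCovering p) (hY : IsConnected Y) {t : ℕ} (ht : IsOfType Z t)
    (y : Y) : e y ^ t ∈ Subgroup.center (As Y) := by
  refine mem_center_of_commute_e fun x => ?_
  obtain ⟨g, rfl⟩ := hY.2 y x
  rw [← conj_e]
  have hz : e y ^ t * g * (e y ^ t)⁻¹ * g⁻¹ ∈ Subgroup.center (As Y) := by
    refine hp.ker_map_le_center ?_
    have hc := Subgroup.mem_center_iff.mp (As.e_pow_mem_center ht (p y)) (map p g)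
    rw [MonoidHom.mem_ker]
    simp only [map_mul, map_inv, map_pow, map_e]
    rw [← hc]
    group
  generalize hzdef : e y ^ t * g * (e y ^ t)⁻¹ * g⁻¹ = z at hz
  have hzg : e y ^ t * g * (e y ^ t)⁻¹ = z * g := by rw [← hzdef]; group
  have hzy := Subgroup.mem_center_iff.mp hz (e y)
  calc e y ^ t * (g⁻¹ * e y * g) * (e y ^ t)⁻¹
      = (e y ^ t * g * (e y ^ t)⁻¹)⁻¹ * e y * (e y ^ t * g * (e y ^ t)⁻¹) := by group
    _ = g⁻¹ * z⁻¹ * (e y * z) * g := by rw [hzg]; group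
    _ = g⁻¹ * e y * g := by rw [hzy]; group

/-- By connectedness the generators are conjugate, and conjugate elements with a central `t`-th
power share that power. -/
theorem e_pow_eq (hp : IsCovering p) (hY : IsConnected Y) {t : ℕ} (ht : IsOfType Z t)
    (x y : Y) : e x ^ t = e y ^ t := by
  obtain ⟨g, rfl⟩ := hY.2 y x
  have hc := Subgroup.mem_center_iff.mp (hp.e_pow_mem_center hY ht y) g⁻¹
  have hconj := conj_pow (a := g⁻¹) (b := e y) (i := t)
  rw [inv_inv] at hconj
  rw [← conj_e, hconj, hc, inv_mul_cancel_right]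

end IsCovering

/-- The central elements of a group whose `t`-th power is trivial. -/
def centralTorsion (G : Type u) [Group G] (t : ℕ) : Subgroup G where
  carrier := {g | g ∈ Subgroup.center G ∧ g ^ t = 1}
  one_mem' := ⟨one_mem _, one_pow t⟩
  mul_mem' {a b} ha hb := ⟨mul_mem ha.1 hb.1, by
    rw [Commute.mul_pow (Subgroup.mem_center_iff.mp hb.1 a), ha.2, hb.2, one_mul]⟩
  inv_mem' ha := ⟨inv_mem ha.1, by rw [inv_pow, ha.2, inv_one]⟩

instance centralTorsion_normal (G : Type u) [Group G] (t : ℕ) : (centralTorsion G t).Normal where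
  conj_mem n hn g := by
    rwa [Subgroup.mem_center_iff.mp hn.1 g, mul_inv_cancel_right]

theorem IsCovering.ker_map_le_centralTorsion {Y : Type u} {Z : Type v} [Quandle Y] [Quandle Z]
    {p : Y →◃ Z} (hp : IsCovering p) (hY : IsConnected Y) {t : ℕ} (ht : IsOfType Z t) :
    (As.map p).ker ≤ centralTorsion (As Y) t := by
  rw [← QuotientGroup.ker_mk' (centralTorsion (As Y) t)]
  refine As.ker_map_le_ker hp.surjective _ fun x y hxy => QuotientGroup.eq.mpr ?_
  have hk : (As.e x)⁻¹ * As.e y ∈ Subgroup.center (As Y) := by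
    refine hp.ker_map_le_center ?_
    rw [MonoidHom.mem_ker, map_mul, map_inv, As.map_e, As.map_e, hxy, inv_mul_cancel]
  refine ⟨hk, ?_⟩
  -- With `k = e_x⁻¹ e_y` central, `e_y ^ t = e_x ^ t * k ^ t`.
  have hpow := (Commute.mul_pow (Subgroup.mem_center_iff.mp hk (As.e x)) t)
  rw [mul_inv_cancel_left, hp.e_pow_eq hY ht y x] at hpow
  exact left_eq_mul.mp hpow

end QuandleCov

theorem proposition5p1 {Y : Type u} {Z : Type v} [Quandle Y] [Quandle Z]
    (p : Y →◃ Z) (hp : QuandleCov.IsCovering p) :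
    QuandleCov.IsCentralExtension (QuandleCov.As.map p) ∧
      (QuandleCov.IsConnected Y → QuandleCov.IsConnected Z →
        ∀ t : ℕ, QuandleCov.IsOfType Z t →
          ∀ k ∈ (QuandleCov.As.map p).ker, k ^ t = 1) :=
  ⟨⟨QuandleCov.As.map_surjective hp.surjective, hp.ker_map_le_center⟩,
    fun hY _ _ ht _ hk => (hp.ker_map_le_centralTorsion hY ht hk).2⟩
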